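/- Theorem. There are universal constants $C>0$ and $n_0>0$ such that the following holds. Let $\mathcal M=(\mathcal S,\mathcal A,P,r,H,\rho)$ be an episodic Markov decision process with discrete state and action spaces, horizon $H$, initial distribution $\rho$, transition distributions $P_h(\cdot\mid s,a)$ and rewards $r_h:\mathcal S\times\mathcal A\to[0,1]$, $h=1,\dots,H$. A policy is $\pi=(\pi_h)_{h=1}^H$ with $\pi_h(\cdot\mid s)$ a probability distribution on $\mathcal A$, and $V(\pi)=\mathbb E\big[\sum_{h=1}^H r_h(s_h,a_h)\big]$ is its value, where $s_1\sim\rho$, $a_h\sim\pi_h(\cdot\mid s_h)$, $s_{h+1}\sim P_h(\cdot\mid s_h,a_h)$. Let $\pi^{\mathrm E}$ be a deterministic expert policy and $\pi^\beta$ a behavior policy (possibly a mixture of policies). In each of $N_{\mathrm{tot}}$ independent rounds, one trajectory is collected, by rolling out $\pi^{\mathrm E}$ with probability $\eta\in[0,1]$ and $\pi^\beta$ with probability $1-\eta$. Let $\mathcal D^{\mathrm E}$ be the resulting dataset of expert trajectories, and let $N_{\mathrm E}=\eta N_{\mathrm{tot}}$ be its expected size. Then $|\mathcal D^{\mathrm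 E}|\sim\mathrm{Bin}(N_{\mathrm{tot}},\eta)$. Moreover, let $\Pi$ be a finite set of policies with $\pi^{\mathrm E}\in\Pi$, and let $\pi^{\mathrm{BC}}$ be any policy selected from the maximum likelihood estimators $$\pi^{\mathrm{BC}}\in\operatorname*{argmax}_{\pi\in\Pi}\ \sum_{h=1}^H\sum_{(s,a)}\widehat d^{\,\mathrm E}_h(s,a)\,\log\pi_h(a\mid s),$$ where $\widehat d^{\,\mathrm E}_h(s,a)$ is the fraction of trajectories in $\mathcal D^{\mathrm E}$ whose state-action pair at step $h$ is $(s,a)$ (zero if $\mathcal D^{\mathrm E}$ is empty), with $\log 0=-\infty$ and $0\cdot(-\infty)=0$. If $N_{\mathrm E}\ge n_0$, then $$\mathbb E\big[V(\pi^{\mathrm E})-V(\pi^{\mathrm{BC}})\big]\ \le\ C\,\min\left\{H,\ H^2\sqrt{\frac{\log(|\Pi|\,H\,N_{\mathrm E})}{N_{\mathrm E}}}\right\},$$ where the expectation is over the data collection. -/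

import Mathlib

universe u v

noncomputable section

namespace OfflineIL

/-- An episodic Markov decision process with horizon `H` on (discrete, possibly infinite) state and
action spaces: initial distribution `ρ`, non-stationary transitions `P h`, and non-stationary
rewards `r h` with values in `[0, 1]`. The step `h ∈ {1, …, H}` is represented by `h : Fin H`. -/
structure MDP (S : Type u) (A : Type v) (H : ℕ) where
  ρ : PMF S
  P : Fin H → S → A → PMF S
  r : Fin H → S → A → ℝ
  r_mem : ∀ h s a, r h s a ∈ Set.Icc (0 : ℝ) 1

/-- Time-dependent (stochastic) policies: `π h s a` is the probability of action `a` in state `s`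
at step `h`. -/
abbrev Policy (S : Type u) (A : Type v) (H : ℕ) : Type (max u v) := Fin H → S → PMF A

/-- Trajectories `(s₁, a₁, …, s_H, a_H)`. -/
abbrev Trajectory (S : Type u) (A : Type v) (H : ℕ) : Type (max u v) := Fin H → S × A

/-- The policy puts all its mass on one action, in every state and at every step. -/
def Policy.IsDeterministic {S : Type u} {A : Type v} {H : ℕ} (π : Policy S A H) : Prop :=
  ∀ h s, ∃ a, π h s = PMF.pure a

/-- Expectation of a real function under a discrete distribution (used for bounded functions only,
for which the series converges absolutely). -/
def expect {α : Type*} (p : PMF α) (f : α → ℝ) : ℝ := ∑' x, (p x).toReal * f x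

namespace MDP

variable {S : Type u} {A : Type v} {H : ℕ} (M : MDP S A H)

/-- Distribution of the state visited after the first `n` state-action pairs `τ`: the initial
distribution if `n = 0`, and otherwise the transition from the last pair of `τ`. -/
def nextState : (n : ℕ) → n < H → (Fin n → S × A) → PMF S
  | 0, _, _ => M.ρ
  | m + 1, hm, τ => M.P ⟨m, Nat.lt_of_succ_lt hm⟩ (τ (Fin.last m)).1 (τ (Fin.last m)).2

/-- Joint law of the first `n` state-action pairs when `π` is rolled out in the MDP. -/
def prefixLaw (π : Policy S A H) : (n : ℕ) → n ≤ H → PMF (Fin n → S × A)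
  | 0, _ => PMF.pure Fin.elim0
  | n + 1, hn =>
      (prefixLaw π n (Nat.le_of_succ_le hn)).bind fun τ =>
        (M.nextState n hn τ).bind fun s =>
          (π ⟨n, hn⟩ s).bind fun a => PMF.pure (Fin.snoc (α := fun _ => S × A) τ (s, a))

/-- Law of the whole trajectory when `π` is rolled out in the MDP. -/
def trajLaw (π : Policy S A H) : PMF (Trajectory S A H) := M.prefixLaw π H le_rfl

/-- Policy value `V(π)`: the expected total reward of a trajectory of `π`. -/
def value (π : Policy S A H) : ℝ :=
  expect (M.trajLaw π) fun τ => ∑ h, M.r h (τ h).1 (τ h).2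

end MDP

section BehavioralCloning

variable {S : Type u} {A : Type v} {H : ℕ}

open Classical in
/-- `n_h(s, a)`: the number of trajectories of the dataset whose pair at step `h` is `(s, a)`. -/
def visitCount (D : Multiset (Trajectory S A H)) (h : Fin H) (x : S × A) : ℕ :=
  D.countP fun τ => τ h = x

/-- Empirical state-action distribution of the dataset at step `h` (zero for an empty dataset). -/
def empiricalDist (D : Multiset (Trajectory S A H)) (h : Fin H) (x : S × A) : ℝ :=
  (visitCount D h x : ℝ) / (Multiset.card D : ℝ)

/-- Log-likelihood objective `∑ h, ∑ (s, a), d̂_h(s, a) * log π_h(a | s)`. It takes values in the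
extended reals, with `log 0 = -∞` and `0 * (-∞) = 0`; the sum over `(s, a)` has only finitely many
nonzero terms. -/
def logLikelihood (D : Multiset (Trajectory S A H)) (π : Policy S A H) : EReal :=
  ∑ h, ∑ᶠ x : S × A, (empiricalDist D h x : EReal) * ENNReal.log (π h x.1 x.2)

/-- `π` is a possible output of behavioral cloning on the dataset `D` with policy class `Pi`:
a maximum likelihood policy in the class. -/
def IsBC (Pi : Finset (Policy S A H)) (D : Multiset (Trajectory S A H)) (π : Policy S A H) :
    Prop :=
  π ∈ Pi ∧ ∀ π' ∈ Pi, logLikelihood D π' ≤ logLikelihood D π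

end BehavioralCloning

section DataCollection

/-- A coin that shows `true` with probability `η`. -/
def coin (η : unitInterval) : PMF Bool :=
  PMF.ofFintype (fun b => if b then ENNReal.ofReal η else ENNReal.ofReal (1 - η)) (by
    have h0 : (0 : ℝ) ≤ η := η.2.1
    have h1 : (0 : ℝ) ≤ 1 - η := sub_nonneg.2 η.2.2
    simp [← ENNReal.ofReal_add h0 h1])

/-- Law of `n` independent draws from `p`. -/
def iidLaw {α : Type*} (p : PMF α) : (n : ℕ) → PMF (Fin n → α)
  | 0 => PMF.pure Fin.elim0
  | n + 1 => (iidLaw p n).bind fun ω =>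
      p.bind fun x => PMF.pure (Fin.snoc (α := fun _ => α) ω x)

variable {S : Type u} {A : Type v} {H : ℕ}

/-- One round of the data collection: with probability `η` roll out the expert `πE` (label `true`),
and with probability `1 - η` roll out the behavior policy (label `false`). The behavior policy may
be a mixture: a policy is drawn from `β` and rolled out (a single policy `π` is
`β = PMF.pure π`). -/
def roundLaw (M : MDP S A H) (πE : Policy S A H) (β : PMF (Policy S A H)) (η : unitInterval) :
    PMF (Bool × Trajectory S A H) :=
  (coin η).bind fun b =>
    (if b then M.trajLaw πE else β.bind M.trajLaw).bind fun τ => PMF.pure (b, τ)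

/-- Law of the labelled dataset obtained from `N` independent rounds. -/
def collectionLaw (M : MDP S A H) (πE : Policy S A H) (β : PMF (Policy S A H))
    (η : unitInterval) (N : ℕ) : PMF (Fin N → Bool × Trajectory S A H) :=
  iidLaw (roundLaw M πE β η) N

/-- The expert dataset: the trajectories of the rounds in which the expert was rolled out. -/
def expertData {N : ℕ} (ω : Fin N → Bool × Trajectory S A H) : Multiset (Trajectory S A H) :=
  (Finset.univ.filter fun i => (ω i).1 = true).val.map fun i => (ω i).2

end DataCollection

end OfflineIL

end

open MeasureTheory ProbabilityTheory
open scoped ENNReal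

namespace OfflineIL

/-! ### Discrete laws on sequences -/

/-! Every log-likelihood is at most 0, and it is 0 exactly when the policy takes each recorded
action with probability one (`logLikelihood_eq_zero_iff`). The deterministic expert lies in the
class and attains 0, so every maximum likelihood policy also fits all expert data perfectly
(`IsBC.agrees`).

Let `d` be the probability that a policy fails to agree with an expert trajectory. Such a policy
loses at most `H * d` in value (`MDP.value_sub_value_le`) and survives all `N` rounds with
probability at most `(1 - η * d) ^ N ≤ exp (-(η * N * d))`. A union bound over policies with `d > ε`
gives the expected gap `H * (ε + |Π| * exp (-(η * N * ε)))` (`expect_gap_le`). Taking `ε = log (|Π|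
* H * NE) / NE` bounds it by `2 * H * ε`, which together with the trivial bound `H` implies the
weaker square-root rate.

Working with independent rounds directly avoids conditioning on the binomial size of the dataset,
whose law is a separate induction by Pascal's rule. -/

theorem bind_pure_snoc_apply {α : Type*} {n : ℕ} (p : PMF (Fin n → α)) (q : (Fin n → α) → PMF α)
    (ω : Fin (n + 1) → α) :
    (p.bind fun τ => (q τ).bind fun x => PMF.pure (Fin.snoc (α := fun _ => α) τ x)) ω
      = p (Fin.init ω) * q (Fin.init ω) (ω (Fin.last n)) := by
  classical
  have key : ∀ τ x, (PMF.pure (Fin.snoc (α := fun _ => α) τ x)) ω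
      = if τ = Fin.init ω then (if x = ω (Fin.last n) then 1 else 0) else (0 : ℝ≥0∞) := by
    intro τ x
    rw [PMF.pure_apply]
    by_cases h : ω = Fin.snoc (α := fun _ => α) τ x
    · have h1 : τ = Fin.init ω := by rw [h, Fin.init_snoc]
      have h2 : x = ω (Fin.last n) := by rw [h, Fin.snoc_last]
      rw [if_pos h, if_pos h1, if_pos h2]
    · rw [if_neg h]
      split_ifs with h1 h2
      · exact absurd (by rw [h1, h2, Fin.snoc_init_self]) h
      · rfl
      · rfl
  rw [PMF.bind_apply, tsum_eq_single (Fin.init ω)]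
  · rw [PMF.bind_apply, tsum_eq_single (ω (Fin.last n))]
    · simp
    · intro x hx
      simp [key, hx]
  · intro τ hτ
    simp [key, hτ]

theorem iidLaw_succ_apply {α : Type*} (p : PMF α) (n : ℕ) (ω : Fin (n + 1) → α) :
    iidLaw p (n + 1) ω = iidLaw p n (Fin.init ω) * p (ω (Fin.last n)) :=
  bind_pure_snoc_apply (iidLaw p n) (fun _ => p) ω

theorem mem_support_of_mem_support_iidLaw {α : Type*} (p : PMF α) :
    ∀ (n : ℕ) (ω : Fin n → α), ω ∈ (iidLaw p n).support → ∀ i, ω i ∈ p.support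
  | 0, _, _, i => i.elim0
  | n + 1, ω, hω, i => by
      rw [PMF.mem_support_iff, iidLaw_succ_apply] at hω
      obtain ⟨h1, h2⟩ := mul_ne_zero_iff.1 hω
      refine Fin.lastCases h2 (fun j => ?_) i
      exact mem_support_of_mem_support_iidLaw p n (Fin.init ω) h1 j

/-- Independence of the rounds in the only form needed. Outer measures make a measurable structure
on `α` unnecessary. -/
theorem iidLaw_toOuterMeasure_forall {α : Type*} (p : PMF α) (G : Set α) :
    ∀ n : ℕ, (iidLaw p n).toOuterMeasure {ω | ∀ i, ω i ∈ G} = p.toOuterMeasure G ^ n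
  | 0 => by
      classical
      rw [iidLaw, PMF.toOuterMeasure_pure_apply, if_pos, pow_zero]
      exact fun i => i.elim0
  | n + 1 => by
      classical
      have step : ∀ ω : Fin n → α,
          (p.bind fun x => PMF.pure (Fin.snoc (α := fun _ => α) ω x)).toOuterMeasure
              {ω | ∀ i, ω i ∈ G}
            = {ω : Fin n → α | ∀ i, ω i ∈ G}.indicator (fun _ => p.toOuterMeasure G) ω := by
        intro ω
        change (p.map fun x => Fin.snoc (α := fun _ => α) ω x).toOuterMeasure _ = _
        rw [PMF.toOuterMeasure_map_apply]
        by_cases h : ∀ i, ω i ∈ G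
        · rw [Set.indicator_of_mem (by exact h)]
          congr 1
          ext x
          simp [Fin.forall_fin_succ', h]
        · rw [Set.indicator_of_notMem (by exact h)]
          have : (fun x => Fin.snoc (α := fun _ => α) ω x) ⁻¹' {ω | ∀ i, ω i ∈ G} = ∅ := by
            ext x
            simpa [Fin.forall_fin_succ'] using fun h' => absurd h' h
          rw [this, measure_empty]
      rw [iidLaw, PMF.toOuterMeasure_bind_apply, pow_succ,
        ← iidLaw_toOuterMeasure_forall p G n, PMF.toOuterMeasure_apply, ← ENNReal.tsum_mul_right]
      refine tsum_congr fun ω => ?_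
      rw [step]
      by_cases h : ω ∈ {ω : Fin n → α | ∀ i, ω i ∈ G}
      · rw [Set.indicator_of_mem h, Set.indicator_of_mem h]
      · rw [Set.indicator_of_notMem h, Set.indicator_of_notMem h, mul_zero, zero_mul]

/-! ### Expectations of bounded functions -/

section Expect

variable {α : Type*} (p : PMF α)

theorem summable_toReal_mul {f : α → ℝ} {B : ℝ} (hf : ∀ x, |f x| ≤ B) :
    Summable fun x => (p x).toReal * f x := by
  have h : Summable fun x => (p x).toReal := ENNReal.summable_toReal p.tsum_coe_ne_top
  refine Summable.of_norm_bounded (h.mul_right B) fun x => ?_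
  rw [Real.norm_eq_abs, abs_mul, abs_of_nonneg ENNReal.toReal_nonneg]
  exact mul_le_mul_of_nonneg_left (hf x) ENNReal.toReal_nonneg

theorem expect_const (c : ℝ) : expect p (fun _ => c) = c := by
  rw [expect, tsum_mul_right, ← ENNReal.tsum_toReal_eq p.apply_ne_top, p.tsum_coe]
  simp

theorem expect_mono {f g : α → ℝ} {B B' : ℝ} (hf : ∀ x, |f x| ≤ B) (hg : ∀ x, |g x| ≤ B')
    (h : ∀ x ∈ p.support, f x ≤ g x) : expect p f ≤ expect p g := by
  refine Summable.tsum_le_tsum (fun x => ?_) (summable_toReal_mul p hf) (summable_toReal_mul p hg)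
  by_cases hx : x ∈ p.support
  · exact mul_le_mul_of_nonneg_left (h x hx) ENNReal.toReal_nonneg
  · simp [(p.apply_eq_zero_iff x).2 hx]

theorem expect_add {f g : α → ℝ} {B B' : ℝ} (hf : ∀ x, |f x| ≤ B) (hg : ∀ x, |g x| ≤ B') :
    expect p (fun x => f x + g x) = expect p f + expect p g := by
  simp only [expect, mul_add]
  exact (summable_toReal_mul p hf).tsum_add (summable_toReal_mul p hg)

theorem expect_const_mul (c : ℝ) (f : α → ℝ) : expect p (fun x => c * f x) = c * expect p f := by
  simp only [expect, mul_left_comm _ c]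
  exact tsum_mul_left

theorem expect_finset_sum {ι : Type*} (s : Finset ι) {f : ι → α → ℝ} {B : ι → ℝ}
    (hf : ∀ i x, |f i x| ≤ B i) :
    expect p (fun x => ∑ i ∈ s, f i x) = ∑ i ∈ s, expect p (f i) := by
  simp only [expect, Finset.mul_sum]
  exact Summable.tsum_finsetSum fun i _ => summable_toReal_mul p (hf i)

theorem abs_indicator_one_le (s : Set α) (x : α) : |s.indicator (1 : α → ℝ) x| ≤ 1 := by
  by_cases h : x ∈ s <;> simp [h]

theorem expect_indicator (s : Set α) :
    expect p (s.indicator 1) = (p.toOuterMeasure s).toReal := by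
  rw [PMF.toOuterMeasure_apply, ENNReal.tsum_toReal_eq]
  · refine tsum_congr fun x => ?_
    by_cases h : x ∈ s <;> simp [h]
  · intro x
    by_cases h : x ∈ s <;> simp [h, p.apply_ne_top]

theorem toReal_toOuterMeasure_add_compl (s : Set α) :
    (p.toOuterMeasure s).toReal + (p.toOuterMeasure sᶜ).toReal = 1 := by
  rw [← expect_indicator, ← expect_indicator,
    ← expect_add p (abs_indicator_one_le s) (abs_indicator_one_le sᶜ)]
  have : (fun x => s.indicator (1 : α → ℝ) x + sᶜ.indicator 1 x) = fun _ => 1 := by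
    funext x
    by_cases h : x ∈ s <;> simp [h]
  rw [this, expect_const]

theorem toOuterMeasure_le_one (s : Set α) : p.toOuterMeasure s ≤ 1 := by
  rw [PMF.toOuterMeasure_apply, ← p.tsum_coe]
  exact ENNReal.tsum_le_tsum fun x => Set.indicator_le_self s p x

end Expect

/-! ### The size of the expert dataset is binomial -/

theorem coin_true (η : unitInterval) : coin η true = ENNReal.ofReal η := rfl

theorem coin_false (η : unitInterval) : coin η false = ENNReal.ofReal (1 - η) := rfl

section CardLaw

variable {S A : Type*} {H : ℕ}

theorem card_expertData {N : ℕ} (ω : Fin N → Bool × Trajectory S A H) :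
    Multiset.card (expertData ω) = ∑ i, if (ω i).1 = true then 1 else 0 := by
  rw [expertData, Multiset.card_map, Finset.sum_boole]
  rfl

theorem card_expertData_snoc {N : ℕ} (ω : Fin N → Bool × Trajectory S A H)
    (x : Bool × Trajectory S A H) :
    Multiset.card (expertData (Fin.snoc (α := fun _ => Bool × Trajectory S A H) ω x))
      = Multiset.card (expertData ω) + if x.1 = true then 1 else 0 := by
  rw [card_expertData, card_expertData, Fin.sum_univ_castSucc]
  simp only [Fin.snoc_castSucc, Fin.snoc_last]

variable (M : MDP S A H) (πE : Policy S A H) (β : PMF (Policy S A H)) (η : unitInterval)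

theorem roundLaw_map_fst : (roundLaw M πE β η).map Prod.fst = coin η := by
  simp [roundLaw, PMF.map_bind, PMF.pure_map, PMF.bind_const]

theorem map_card_collectionLaw_succ (N : ℕ) :
    (collectionLaw M πE β η (N + 1)).map (fun ω => Multiset.card (expertData ω))
      = ((collectionLaw M πE β η N).map fun ω => Multiset.card (expertData ω)).bind fun c =>
          (coin η).bind fun b => PMF.pure (c + if b = true then 1 else 0) := by
  rw [collectionLaw, iidLaw, PMF.map_bind, PMF.bind_map, collectionLaw]
  congr 1
  funext ω
  rw [PMF.map_bind, Function.comp_apply, ← roundLaw_map_fst M πE β η, PMF.bind_map]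
  congr 1
  funext x
  rw [PMF.pure_map, Function.comp_apply, card_expertData_snoc]

theorem bind_coin_apply_zero (p : PMF ℕ) :
    (p.bind fun c => (coin η).bind fun b => PMF.pure (c + if b = true then 1 else 0)) 0
      = p 0 * ENNReal.ofReal (1 - η) := by
  rw [PMF.bind_apply, tsum_eq_single 0]
  · simp [PMF.bind_apply, PMF.pure_apply, coin_false]
  · intro c hc
    simp [PMF.bind_apply, PMF.pure_apply, hc.symm]

theorem bind_coin_apply_succ (p : PMF ℕ) (k : ℕ) :
    (p.bind fun c => (coin η).bind fun b => PMF.pure (c + if b = true then 1 else 0)) (k + 1)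
      = p (k + 1) * ENNReal.ofReal (1 - η) + p k * ENNReal.ofReal η := by
  have h : ∀ c, p c * ((coin η).bind fun b => PMF.pure (c + if b = true then 1 else 0)) (k + 1)
      = (if c = k + 1 then p c * ENNReal.ofReal (1 - η) else 0)
        + if c = k then p c * ENNReal.ofReal η else 0 := by
    intro c
    by_cases h1 : c = k + 1
    · simp [PMF.bind_apply, PMF.pure_apply, coin_false, h1]
    · by_cases h2 : c = k
      · simp [PMF.bind_apply, PMF.pure_apply, coin_true, h2]
      · simp [PMF.bind_apply, PMF.pure_apply, h1, h2, Ne.symm h1, Ne.symm h2]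
  rw [PMF.bind_apply, tsum_congr h, ENNReal.tsum_add, tsum_ite_eq, tsum_ite_eq]

theorem map_card_collectionLaw_apply (N k : ℕ) :
    ((collectionLaw M πE β η N).map fun ω => Multiset.card (expertData ω)) k
      = ENNReal.ofReal (N.choose k * (η : ℝ) ^ k * (1 - η) ^ (N - k)) := by
  have h0 : (0 : ℝ) ≤ η := η.2.1
  have h1 : (0 : ℝ) ≤ 1 - η := sub_nonneg.2 η.2.2
  induction N generalizing k with
  | zero =>
    have : ((collectionLaw M πE β η 0).map fun ω => Multiset.card (expertData ω))
        = PMF.pure 0 := by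
      rw [collectionLaw, iidLaw, PMF.pure_map]
      simp [card_expertData]
    rw [this, PMF.pure_apply]
    cases k <;> simp
  | succ N ih =>
    rw [map_card_collectionLaw_succ]
    cases k with
    | zero =>
      rw [bind_coin_apply_zero, ih, ← ENNReal.ofReal_mul (by positivity)]
      congr 1
      simp [pow_succ]
    | succ k =>
      rw [bind_coin_apply_succ, ih, ih, ← ENNReal.ofReal_mul (by positivity),
        ← ENNReal.ofReal_mul (by positivity), ← ENNReal.ofReal_add (by positivity) (by positivity)]
      congr 1
      rw [Nat.choose_succ_succ, Nat.add_sub_add_right]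
      push_cast
      -- The exponent `N - (k + 1)` is truncated when `N ≤ k`; there `N.choose (k + 1) = 0` kills
      -- its term.
      rcases Nat.lt_or_ge k N with hk | hk
      · obtain ⟨m, rfl⟩ := Nat.exists_eq_add_of_lt hk
        rw [show k + m + 1 - (k + 1) = m by omega, show k + m + 1 - k = m + 1 by omega]
        ring
      · rw [Nat.choose_eq_zero_of_lt (Nat.lt_succ_of_le hk)]
        push_cast
        ring

theorem map_card_collectionLaw_toMeasure (N : ℕ) :
    ((collectionLaw M πE β η N).map fun ω => Multiset.card (expertData ω)).toMeasure
      = binomial N η := by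
  refine Measure.ext_of_singleton fun k => ?_
  rw [PMF.toMeasure_apply_singleton _ _ (measurableSet_singleton k), map_card_collectionLaw_apply,
    binomial_singleton]

end CardLaw

/-! ### Rolling out policies that agree along a trajectory -/

section Agreement

variable {S A : Type*} {H : ℕ}

/-- Along the trajectory `τ`, the policy `π` chooses every action with probability one. -/
def Policy.Agrees (π : Policy S A H) (τ : Trajectory S A H) : Prop :=
  ∀ h, π h (τ h).1 (τ h).2 = 1

theorem Policy.IsDeterministic.apply_eq_one {π : Policy S A H} (hπ : π.IsDeterministic)
    {h : Fin H} {s : S} {a : A} (ha : π h s a ≠ 0) : π h s a = 1 := by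
  obtain ⟨b, hb⟩ := hπ h s
  rw [hb] at ha ⊢
  rw [← PMF.mem_support_iff, PMF.mem_support_pure_iff] at ha
  rw [ha, PMF.pure_apply_self]

variable (M : MDP S A H)

theorem MDP.prefixLaw_succ_apply (π : Policy S A H) (n : ℕ) (hn : n + 1 ≤ H)
    (τ : Fin (n + 1) → S × A) :
    M.prefixLaw π (n + 1) hn τ
      = M.prefixLaw π n (Nat.le_of_succ_le hn) (Fin.init τ)
        * (M.nextState n hn (Fin.init τ) (τ (Fin.last n)).1
          * π ⟨n, hn⟩ (τ (Fin.last n)).1 (τ (Fin.last n)).2) := by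
  classical
  -- Merging the state and action draws into a single draw of a pair makes `bind_pure_snoc_apply`
  -- applicable.
  have h : M.prefixLaw π (n + 1) hn
      = (M.prefixLaw π n (Nat.le_of_succ_le hn)).bind fun τ =>
          ((M.nextState n hn τ).bind fun s => (π ⟨n, hn⟩ s).bind fun a => PMF.pure (s, a)).bind
            fun x => PMF.pure (Fin.snoc (α := fun _ => S × A) τ x) := by
    simp [MDP.prefixLaw, PMF.bind_bind, PMF.pure_bind]
  rw [h, bind_pure_snoc_apply]
  congr 1
  generalize τ (Fin.last n) = x
  obtain ⟨s, a⟩ := x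
  rw [PMF.bind_apply, tsum_eq_single s]
  · rw [PMF.bind_apply, tsum_eq_single a]
    · simp
    · intro b hb
      simp [PMF.pure_apply, hb.symm]
  · intro t ht
    simp [PMF.bind_apply, PMF.pure_apply, ht.symm]

/-- Both laws share the initial and transition factors; the action factors are at most 1 for `π` and
equal to 1 for `π'`. -/
theorem MDP.prefixLaw_le_of_agrees (π π' : Policy S A H) :
    ∀ (n : ℕ) (hn : n ≤ H) (τ : Fin n → S × A),
      (∀ i : Fin n, π' ⟨i, i.2.trans_le hn⟩ (τ i).1 (τ i).2 = 1) →
        M.prefixLaw π n hn τ ≤ M.prefixLaw π' n hn τ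
  | 0, _, _, _ => le_rfl
  | n + 1, hn, τ, h => by
      rw [prefixLaw_succ_apply, prefixLaw_succ_apply]
      have hlast : π' ⟨n, hn⟩ (τ (Fin.last n)).1 (τ (Fin.last n)).2 = 1 := h (Fin.last n)
      rw [hlast]
      gcongr
      · exact prefixLaw_le_of_agrees π π' n _ _ fun i => h i.castSucc
      · exact PMF.coe_le_one _ _

theorem MDP.apply_ne_zero_of_prefixLaw_ne_zero (π : Policy S A H) :
    ∀ (n : ℕ) (hn : n ≤ H) (τ : Fin n → S × A), M.prefixLaw π n hn τ ≠ 0 →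
      ∀ i : Fin n, π ⟨i, i.2.trans_le hn⟩ (τ i).1 (τ i).2 ≠ 0
  | 0, _, _, _, i => i.elim0
  | n + 1, hn, τ, h, i => by
      rw [prefixLaw_succ_apply] at h
      obtain ⟨h1, h2⟩ := mul_ne_zero_iff.1 h
      refine Fin.lastCases (mul_ne_zero_iff.1 h2).2 (fun j => ?_) i
      exact apply_ne_zero_of_prefixLaw_ne_zero π n _ (Fin.init τ) h1 j

theorem MDP.trajLaw_le_of_agrees (π : Policy S A H) {π' : Policy S A H} {τ : Trajectory S A H}
    (h : π'.Agrees τ) : M.trajLaw π τ ≤ M.trajLaw π' τ :=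
  M.prefixLaw_le_of_agrees π π' H le_rfl τ h

theorem MDP.agrees_of_mem_support_trajLaw {π : Policy S A H} (hπ : π.IsDeterministic)
    {τ : Trajectory S A H} (hτ : τ ∈ (M.trajLaw π).support) : π.Agrees τ := fun h =>
  hπ.apply_eq_one (M.apply_ne_zero_of_prefixLaw_ne_zero π H le_rfl τ hτ h)

/-- The total reward of a trajectory. -/
def MDP.totalReward (τ : Trajectory S A H) : ℝ := ∑ h, M.r h (τ h).1 (τ h).2

theorem MDP.totalReward_nonneg (τ : Trajectory S A H) : 0 ≤ M.totalReward τ :=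
  Finset.sum_nonneg fun h _ => (M.r_mem h _ _).1

theorem MDP.totalReward_le (τ : Trajectory S A H) : M.totalReward τ ≤ H := by
  refine (Finset.sum_le_card_nsmul _ _ 1 fun h _ => (M.r_mem h _ _).2).trans ?_
  simp

theorem MDP.abs_totalReward_le (τ : Trajectory S A H) : |M.totalReward τ| ≤ H := by
  rw [abs_of_nonneg (M.totalReward_nonneg τ)]
  exact M.totalReward_le τ

theorem MDP.value_eq_expect (π : Policy S A H) :
    M.value π = expect (M.trajLaw π) M.totalReward := rfl

theorem MDP.value_nonneg (π : Policy S A H) : 0 ≤ M.value π :=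
  tsum_nonneg fun τ => mul_nonneg ENNReal.toReal_nonneg (M.totalReward_nonneg τ)

theorem MDP.value_le (π : Policy S A H) : M.value π ≤ H := by
  rw [value_eq_expect, ← expect_const (M.trajLaw π) (H : ℝ)]
  exact expect_mono _ M.abs_totalReward_le (fun _ => le_rfl) fun τ _ => M.totalReward_le τ

theorem MDP.abs_value_sub_value_le (π π' : Policy S A H) : |M.value π - M.value π'| ≤ H := by
  have h1 := M.value_nonneg π
  have h2 := M.value_le π
  have h3 := M.value_nonneg π'
  have h4 := M.value_le π'
  rw [abs_le]
  constructor <;> linarith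

/-- The probability that `π'` does not agree with a trajectory of `π`. -/
noncomputable def MDP.disagreement (π π' : Policy S A H) : ℝ :=
  ((M.trajLaw π).toOuterMeasure {τ | π'.Agrees τ}ᶜ).toReal

theorem MDP.disagreement_le_one (π π' : Policy S A H) : M.disagreement π π' ≤ 1 :=
  ENNReal.toReal_le_of_le_ofReal zero_le_one (by simpa using toOuterMeasure_le_one _ _)

/-- Where `π'` agrees, it gives a trajectory at least the mass that `π` does, so with nonnegative
rewards nothing is lost there. Elsewhere the loss is at most the total reward, hence at most `H`.
Comparing whole trajectories keeps the bound linear in `H`. -/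
theorem MDP.value_sub_value_le (π π' : Policy S A H) :
    M.value π - M.value π' ≤ H * M.disagreement π π' := by
  rw [disagreement, ← expect_indicator, ← expect_const_mul, sub_le_iff_le_add]
  have h1 := summable_toReal_mul (M.trajLaw π)
    (f := fun τ => (H : ℝ) * ({τ | π'.Agrees τ}ᶜ : Set (Trajectory S A H)).indicator 1 τ) (B := H)
    fun τ => by
      rw [abs_mul, Nat.abs_cast]
      exact mul_le_of_le_one_right (Nat.cast_nonneg H) (abs_indicator_one_le _ τ)
  have h2 := summable_toReal_mul (M.trajLaw π') M.abs_totalReward_le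
  rw [value_eq_expect, value_eq_expect, expect, expect, expect, ← h1.tsum_add h2]
  refine Summable.tsum_le_tsum (fun τ => ?_)
    (summable_toReal_mul (M.trajLaw π) M.abs_totalReward_le) (h1.add h2)
  by_cases h : π'.Agrees τ
  · rw [Set.indicator_of_notMem (by simpa using h), mul_zero, mul_zero, zero_add]
    exact mul_le_mul_of_nonneg_right
      (ENNReal.toReal_mono (PMF.apply_ne_top _ _) (M.trajLaw_le_of_agrees π h))
      (M.totalReward_nonneg τ)
  · rw [Set.indicator_of_mem (by simpa using h), Pi.one_apply, mul_one]
    refine le_add_of_le_of_nonneg ?_ (mul_nonneg ENNReal.toReal_nonneg (M.totalReward_nonneg τ))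
    exact mul_le_mul_of_nonneg_left (M.totalReward_le τ) ENNReal.toReal_nonneg

end Agreement

/-! ### Maximum likelihood in a class containing an agreeing policy -/

section MaximumLikelihood

variable {S A : Type*} {H : ℕ}

theorem empiricalDist_nonneg (D : Multiset (Trajectory S A H)) (h : Fin H) (x : S × A) :
    0 ≤ empiricalDist D h x := by
  unfold empiricalDist
  positivity

theorem empiricalDist_ne_zero_iff {D : Multiset (Trajectory S A H)} {h : Fin H} {x : S × A} :
    empiricalDist D h x ≠ 0 ↔ ∃ τ ∈ D, τ h = x := by
  classical
  rw [empiricalDist, div_ne_zero_iff, Nat.cast_ne_zero, Nat.cast_ne_zero, visitCount,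
    ← Nat.pos_iff_ne_zero, Multiset.countP_pos]
  refine ⟨fun h => h.1, fun h => ⟨h, ?_⟩⟩
  obtain ⟨τ, hτ, -⟩ := h
  exact (Multiset.card_pos_iff_exists_mem.2 ⟨τ, hτ⟩).ne'

theorem empiricalDist_mul_log_nonpos (D : Multiset (Trajectory S A H)) (π : Policy S A H)
    (h : Fin H) (x : S × A) :
    (empiricalDist D h x : EReal) * ENNReal.log (π h x.1 x.2) ≤ 0 := by
  refine EReal.mul_nonpos_iff.2 (Or.inl ⟨?_, ?_⟩)
  · exact_mod_cast empiricalDist_nonneg D h x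
  · rw [← ENNReal.log_one]
    exact ENNReal.log_monotone (PMF.coe_le_one _ _)

theorem finite_support_empiricalDist_mul_log (D : Multiset (Trajectory S A H)) (π : Policy S A H)
    (h : Fin H) :
    (Function.support fun x : S × A =>
      (empiricalDist D h x : EReal) * ENNReal.log (π h x.1 x.2)).Finite := by
  classical
  refine ((D.map fun τ => τ h).toFinset.finite_toSet).subset fun x hx => ?_
  have h0 : empiricalDist D h x ≠ 0 := by
    intro h0
    simp [h0] at hx
  simpa using empiricalDist_ne_zero_iff.1 h0

theorem finsum_empiricalDist_mul_log_nonpos (D : Multiset (Trajectory S A H)) (π : Policy S A H)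
    (h : Fin H) :
    ∑ᶠ x : S × A, (empiricalDist D h x : EReal) * ENNReal.log (π h x.1 x.2) ≤ 0 := by
  rw [finsum_eq_sum _ (finite_support_empiricalDist_mul_log D π h)]
  exact Finset.sum_nonpos fun x _ => empiricalDist_mul_log_nonpos D π h x

/-- All terms are nonpositive, so the sum vanishes only termwise; a visited pair has nonzero weight,
which forces its logarithm to be 0. -/
theorem logLikelihood_eq_zero_iff {D : Multiset (Trajectory S A H)} {π : Policy S A H} :
    logLikelihood D π = 0 ↔ ∀ τ ∈ D, π.Agrees τ := by
  rw [logLikelihood,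
    Finset.sum_eq_zero_iff_of_nonpos fun h _ => finsum_empiricalDist_mul_log_nonpos D π h]
  constructor
  · intro hz τ hτ h
    have hh := hz h (Finset.mem_univ h)
    have hfin := finite_support_empiricalDist_mul_log D π h
    rw [finsum_eq_sum _ hfin,
      Finset.sum_eq_zero_iff_of_nonpos fun x _ => empiricalDist_mul_log_nonpos D π h x] at hh
    have hx : (empiricalDist D h (τ h) : EReal) * ENNReal.log (π h (τ h).1 (τ h).2) = 0 := by
      by_contra hne
      exact hne (hh _ (hfin.mem_toFinset.2 hne))
    have hd : empiricalDist D h (τ h) ≠ 0 := empiricalDist_ne_zero_iff.2 ⟨τ, hτ, rfl⟩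
    rcases mul_eq_zero.1 hx with h0 | h0
    · exact absurd (by exact_mod_cast h0) hd
    · exact ENNReal.log_injective (h0.trans ENNReal.log_one.symm)
  · intro hag h _
    rw [← finsum_zero (α := S × A) (M := EReal)]
    refine finsum_congr fun x => ?_
    by_cases h0 : empiricalDist D h x = 0
    · simp [h0]
    · obtain ⟨τ, hτ, rfl⟩ := empiricalDist_ne_zero_iff.1 h0
      rw [hag τ hτ h, ENNReal.log_one, mul_zero]

theorem logLikelihood_nonpos (D : Multiset (Trajectory S A H)) (π : Policy S A H) :
    logLikelihood D π ≤ 0 :=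
  Finset.sum_nonpos fun h _ => finsum_empiricalDist_mul_log_nonpos D π h

theorem IsBC.agrees {Pi : Finset (Policy S A H)} {D : Multiset (Trajectory S A H)}
    {π π' : Policy S A H} (hπ : IsBC Pi D π) (hmem : π' ∈ Pi) (hag : ∀ τ ∈ D, π'.Agrees τ) :
    ∀ τ ∈ D, π.Agrees τ := by
  rw [← logLikelihood_eq_zero_iff] at hag ⊢
  exact le_antisymm (logLikelihood_nonpos D π) (hag ▸ hπ.2 π' hmem)

end MaximumLikelihood

/-! ### The imitation gap -/

section ImitationGap

variable {S A : Type*} {H : ℕ}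

/-- The outcomes of a round that do not refute the policy `π`: those in which the expert was not
rolled out, or in which `π` agrees with the expert trajectory. -/
def consistentRounds (π : Policy S A H) : Set (Bool × Trajectory S A H) :=
  {x | x.1 = true → π.Agrees x.2}

theorem mem_expertData {N : ℕ} {ω : Fin N → Bool × Trajectory S A H} {τ : Trajectory S A H} :
    τ ∈ expertData ω ↔ ∃ i, (ω i).1 = true ∧ (ω i).2 = τ := by
  simp [expertData]

theorem forall_expertData_agrees_iff {N : ℕ} {ω : Fin N → Bool × Trajectory S A H}
    {π : Policy S A H} :
    (∀ τ ∈ expertData ω, π.Agrees τ) ↔ ∀ i, ω i ∈ consistentRounds π := by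
  simp only [mem_expertData, consistentRounds, Set.mem_ofPred_eq]
  exact ⟨fun h i hi => h _ ⟨i, hi, rfl⟩, fun h τ ⟨i, hi, hτ⟩ => hτ ▸ h i hi⟩

variable (M : MDP S A H) {πE : Policy S A H} (β : PMF (Policy S A H)) (η : unitInterval)

theorem support_roundLaw_subset (hE : πE.IsDeterministic) :
    (roundLaw M πE β η).support ⊆ consistentRounds πE := by
  rintro ⟨b, τ⟩ hx hb
  obtain rfl : b = true := hb
  simp only [roundLaw, PMF.mem_support_bind_iff, PMF.mem_support_pure_iff, Prod.mk.injEq] at hx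
  obtain ⟨_, -, τ', hτ', rfl, rfl⟩ := hx
  exact M.agrees_of_mem_support_trajLaw hE hτ'

/-- A round refutes `π` when the coin selects the expert and `π` disagrees with the resulting
trajectory. -/
theorem roundLaw_consistentRounds_le (π : Policy S A H) :
    ((roundLaw M πE β η).toOuterMeasure (consistentRounds π)).toReal
      ≤ 1 - η * M.disagreement πE π := by
  have h0 : (0 : ℝ) ≤ η := η.2.1
  have h1 : (0 : ℝ) ≤ 1 - η := sub_nonneg.2 η.2.2
  set q := (M.trajLaw πE).toOuterMeasure {τ | π.Agrees τ} with hq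
  have hq_top : q ≠ ∞ := ((toOuterMeasure_le_one _ _).trans_lt ENNReal.one_lt_top).ne
  have hle : (roundLaw M πE β η).toOuterMeasure (consistentRounds π)
      ≤ ENNReal.ofReal (1 - η) + ENNReal.ofReal η * q := by
    rw [roundLaw, PMF.toOuterMeasure_bind_apply, tsum_bool, coin_true, coin_false]
    gcongr
    · exact mul_le_of_le_one_right' (toOuterMeasure_le_one _ _)
    · change ((M.trajLaw πE).map fun τ => (true, τ)).toOuterMeasure _ ≤ _
      rw [PMF.toOuterMeasure_map_apply, hq]
      exact measure_mono fun τ hτ => hτ rfl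
  have hsum : q.toReal + M.disagreement πE π = 1 :=
    toReal_toOuterMeasure_add_compl (M.trajLaw πE) {τ | π.Agrees τ}
  calc _ ≤ (ENNReal.ofReal (1 - η) + ENNReal.ofReal η * q).toReal :=
        ENNReal.toReal_mono (by finiteness) hle
    _ = (1 - η) + η * q.toReal := by
        rw [ENNReal.toReal_add (by finiteness) (by finiteness), ENNReal.toReal_mul,
          ENNReal.toReal_ofReal h0, ENNReal.toReal_ofReal h1]
    _ = 1 - η * M.disagreement πE π := by
        linear_combination (η : ℝ) * hsum

theorem collectionLaw_consistent_le (π : Policy S A H) (N : ℕ) :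
    ((collectionLaw M πE β η N).toOuterMeasure {ω | ∀ i, ω i ∈ consistentRounds π}).toReal
      ≤ Real.exp (-(η * N * M.disagreement πE π)) := by
  rw [collectionLaw, iidLaw_toOuterMeasure_forall, ENNReal.toReal_pow]
  calc _ ≤ Real.exp (-(η * M.disagreement πE π)) ^ N :=
        pow_le_pow_left₀ ENNReal.toReal_nonneg
          ((roundLaw_consistentRounds_le M β η π).trans (Real.one_sub_le_exp_neg _)) N
    _ = _ := by
        rw [← Real.exp_nat_mul]
        congr 1
        ring

variable {β η} in
theorem expect_gap_le (hE : πE.IsDeterministic) {Pi : Finset (Policy S A H)} (hPi : πE ∈ Pi)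
    {N : ℕ} {πBC : (Fin N → Bool × Trajectory S A H) → Policy S A H}
    (hBC : ∀ ω, IsBC Pi (expertData ω) (πBC ω)) {ε : ℝ} (hε : 0 ≤ ε) :
    expect (collectionLaw M πE β η N) (fun ω => M.value πE - M.value (πBC ω))
      ≤ H * (ε + Pi.card * Real.exp (-(η * N * ε))) := by
  classical
  set p := collectionLaw M πE β η N
  -- `πBC ω` depends on the data, so the union bound runs over all bad policies of the class; `I π`
  -- indicates that `π` survives every round.
  set F := Pi.filter fun π => ε < M.disagreement πE π
  let I : Policy S A H → (Fin N → Bool × Trajectory S A H) → ℝ := fun π =>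
    {ω | ∀ i, ω i ∈ consistentRounds π}.indicator 1
  have hI0 : ∀ π ω, 0 ≤ I π ω := fun π ω => Set.indicator_nonneg (fun _ _ => zero_le_one) ω
  have hI1 : ∀ π ω, |I π ω| ≤ 1 := fun π ω => abs_indicator_one_le _ ω
  have hsum : ∀ ω, |∑ π ∈ F, I π ω| ≤ ∑ _π ∈ F, (1 : ℝ) := fun ω =>
    (Finset.abs_sum_le_sum_abs _ _).trans (Finset.sum_le_sum fun π _ => hI1 π ω)
  have hadd : ∀ ω, |ε + ∑ π ∈ F, I π ω| ≤ |ε| + ∑ _π ∈ F, (1 : ℝ) := fun ω =>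
    (abs_add_le _ _).trans (by gcongr; exact hsum ω)
  calc expect p (fun ω => M.value πE - M.value (πBC ω))
      ≤ expect p (fun ω => H * (ε + ∑ π ∈ F, I π ω)) := by
        refine expect_mono p (fun ω => M.abs_value_sub_value_le _ _)
          (B' := H * (|ε| + ∑ _π ∈ F, (1 : ℝ))) (fun ω => ?_) fun ω hω => ?_
        · rw [abs_mul, Nat.abs_cast]
          gcongr
          exact hadd ω
        · refine (M.value_sub_value_le _ _).trans ?_
          gcongr
          have hcons : ∀ i, ω i ∈ consistentRounds (πBC ω) := by
            refine forall_expertData_agrees_iff.1 ((hBC ω).agrees hPi ?_)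
            exact forall_expertData_agrees_iff.2 fun i =>
              support_roundLaw_subset M β η hE (mem_support_of_mem_support_iidLaw _ N ω hω i)
          -- A bad output has survived, so its own indicator contributes 1, which dominates any
          -- disagreement.
          by_cases hd : ε < M.disagreement πE (πBC ω)
          · have h1 : I (πBC ω) ω ≤ ∑ π ∈ F, I π ω :=
              Finset.single_le_sum (f := fun π => I π ω) (fun π _ => hI0 π ω)
                (Finset.mem_filter.2 ⟨(hBC ω).1, hd⟩)
            have h2 : I (πBC ω) ω = 1 := Set.indicator_of_mem (by exact hcons) _
            have h3 := M.disagreement_le_one πE (πBC ω)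
            linarith
          · have h1 : 0 ≤ ∑ π ∈ F, I π ω := Finset.sum_nonneg fun π _ => hI0 π ω
            linarith
    _ = H * (ε + ∑ π ∈ F, expect p (I π)) := by
        rw [expect_const_mul, expect_add p (fun _ => le_rfl) hsum, expect_const,
          expect_finset_sum p F hI1]
    _ ≤ H * (ε + ∑ _π ∈ F, Real.exp (-(η * N * ε))) := by
        gcongr with π hπ
        rw [expect_indicator]
        refine (collectionLaw_consistent_le M β η π N).trans ?_
        have h0 : (0 : ℝ) ≤ η := η.2.1
        gcongr
        exact (Finset.mem_filter.1 hπ).2.le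
    _ ≤ H * (ε + Pi.card * Real.exp (-(η * N * ε))) := by
        rw [Finset.sum_const, nsmul_eq_mul]
        gcongr
        exact Finset.filter_subset _ _

theorem expect_gap_le_horizon {N : ℕ}
    (πBC : (Fin N → Bool × Trajectory S A H) → Policy S A H) :
    expect (collectionLaw M πE β η N) (fun ω => M.value πE - M.value (πBC ω)) ≤ H := by
  rw [← expect_const (collectionLaw M πE β η N) (H : ℝ)]
  exact expect_mono _ (fun ω => M.abs_value_sub_value_le _ _) (fun _ => le_rfl)
    fun ω _ => (le_abs_self _).trans (M.abs_value_sub_value_le _ _)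

end ImitationGap

theorem le_two_mul_min_sqrt {H k n g : ℝ} (hH : 1 ≤ H) (hk : 1 ≤ k) (hn : 3 ≤ n) (hgH : g ≤ H)
    (hg : ∀ ε, 0 ≤ ε → g ≤ H * (ε + k * Real.exp (-(n * ε)))) :
    g ≤ 2 * min H (H ^ 2 * √(Real.log (k * H * n) / n)) := by
  have hn0 : 0 < n := by linarith
  have hkH : 1 ≤ k * H := one_le_mul_of_one_le_of_one_le hk hH
  -- This is where `3 ≤ n` enters, through `exp 1 < 3`.
  have hlog : 1 ≤ Real.log (k * H * n) := by
    rw [Real.le_log_iff_exp_le (by positivity)]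
    have h3 : n ≤ k * H * n := le_mul_of_one_le_left hn0.le hkH
    linarith [Real.exp_one_lt_d9]
  set x := Real.log (k * H * n) / n with hx
  have hx0 : 0 ≤ x := by positivity
  -- The choice of `x` turns the left side into `1 / (H * n)`.
  have hexp : k * Real.exp (-(n * x)) ≤ x := by
    rw [hx, mul_div_cancel₀ _ hn0.ne', Real.exp_neg, Real.exp_log (by positivity)]
    calc k * (k * H * n)⁻¹ = H⁻¹ / n := by field_simp
      _ ≤ Real.log (k * H * n) / n := by
        gcongr
        exact (inv_le_one_of_one_le₀ hH).trans hlog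
  have hgx : g ≤ 2 * (H * x) := (hg x hx0).trans (by nlinarith)
  have hHH : H ≤ H ^ 2 := by nlinarith
  rw [mul_min_of_nonneg _ _ zero_le_two, le_min_iff]
  refine ⟨by linarith, ?_⟩
  -- For `x ≤ 1` the linear rate is below the square-root rate; for `x ≥ 1` the trivial bound `H`
  -- suffices.
  rcases le_total x 1 with h | h
  · have hsq : x ≤ √x := Real.le_sqrt_of_sq_le (by nlinarith)
    calc g ≤ 2 * (H * x) := hgx
      _ ≤ 2 * (H ^ 2 * √x) := by gcongr
  · have hsq : 1 ≤ √x := Real.one_le_sqrt.2 h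
    calc g ≤ H * 1 := by linarith
      _ ≤ H ^ 2 * √x := by gcongr
      _ ≤ 2 * (H ^ 2 * √x) := by linarith [show 0 ≤ H ^ 2 * √x by positivity]

end OfflineIL

theorem mainTheorem9 :
    ∃ C n₀ : ℝ, 0 < C ∧ 0 < n₀ ∧
      ∀ (S : Type*) (A : Type*) (H : ℕ) (M : OfflineIL.MDP S A H)
        (πE : OfflineIL.Policy S A H) (β : PMF (OfflineIL.Policy S A H))
        (η : unitInterval) (Ntot : ℕ),
        πE.IsDeterministic →
        -- the number of expert trajectories is binomial
        ((OfflineIL.collectionLaw M πE β η Ntot).map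
            (fun ω => Multiset.card (OfflineIL.expertData ω))).toMeasure
          = ProbabilityTheory.binomial Ntot η ∧
        -- the imitation gap, with `NE` the expected number of expert trajectories
        ∀ (Pi : Finset (OfflineIL.Policy S A H)), πE ∈ Pi →
          ∀ πBC : (Fin Ntot → Bool × OfflineIL.Trajectory S A H) → OfflineIL.Policy S A H,
            (∀ ω, OfflineIL.IsBC Pi (OfflineIL.expertData ω) (πBC ω)) →
            ∀ NE : ℝ, NE = (η : ℝ) * (Ntot : ℝ) → n₀ ≤ NE →
              OfflineIL.expect (OfflineIL.collectionLaw M πE β η Ntot)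
                  (fun ω => M.value πE - M.value (πBC ω))
                ≤ C * min (H : ℝ)
                    ((H : ℝ) ^ 2 * √(Real.log ((Pi.card : ℝ) * (H : ℝ) * NE) / NE)) := by
  refine ⟨2, 3, two_pos, three_pos, fun S A H M πE β η N hE =>
    ⟨OfflineIL.map_card_collectionLaw_toMeasure M πE β η N, ?_⟩⟩
  rintro Pi hPi πBC hBC _ rfl hn
  have hgH := OfflineIL.expect_gap_le_horizon M (πE := πE) β η πBC
  rcases Nat.eq_zero_or_pos H with rfl | hH
  -- With horizon 0 the right side is 0, and the trivial bound already gives this.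
  · simpa using hgH
  · exact OfflineIL.le_two_mul_min_sqrt (Nat.one_le_cast.2 hH)
      (Nat.one_le_cast.2 (Finset.card_pos.2 ⟨πE, hPi⟩)) hn hgH
      fun ε hε => OfflineIL.expect_gap_le M hE hPi hBC hε
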